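/- **Proposition (Prox-regularity via stacked amenability).** Let $A,V\in\mathbb{R}^{n\times n}$ with $V$ symmetric positive definite, let $0\le N\le k$ be integers, $\zeta\in\mathbb{R}$, and for each time $j$ let $\hat x_{j|j-1},\hat x_{j|j}\in\mathbb{R}^n$ (predicted and corrected state estimates) and $z_j\in\mathbb{R}$ (quadratic measurement) be given. Put $H_j=(2V\hat x_{j|j-1})^\top$, $\tilde z_j=z_j-\hat x_{j|j}^\top V\hat x_{j|j}$, $L=\|V\|_2$, and, for $A$ invertible and $i=0,\dots,N$, $$\delta_{k,i}(x)=\zeta+L\,\|A^{-i}x-\hat x_{k-i|k-i}\|^2,\qquad \varphi_i^{\pm}(x)=\pm\bigl(H_{k-i}(A^{-i}x-\hat x_{k-i|k-i})-\tilde z_{k-i}\bigr)-\delta_{k,i}(x).$$ Let $F=(\varphi_0^+,\varphi_0^-,\dots,\varphi_N^+,\varphi_N^-):\mathbb{R}^n\to\mathbb{R}^{2(N+1)}$, $D=(-\infty,0]^{2(N+1)}$ and $\mathcal F_k=\{x\in\mathbb{R}^n: F(x)\in D\}$, and let $\bar x\in\mathcal F_k$. Assume: 1. $A$ is invertible; 2.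 for all $i=0,\dots,N$ and $s\in\{+,-\}$, if $\varphi_i^s(\bar x)=0$ then $\nabla\varphi_i^s(\bar x)\ne0$; 3. the only $y\in N_D(F(\bar x))$ with $\nabla F(\bar x)^*y=0$ is $y=0$. Then $\mathcal F_k$ is strongly amenable at $\bar x$ and prox-regular at $\bar x$. Here, for a set $C$ and $x\in C$, the normal cone $N_C(x)$ consists of all limits of vectors $v^\nu$ with $x^\nu\to x$, $x^\nu\in C$, and $\langle v^\nu,y-x^\nu\rangle\le o(\|y-x^\nu\|)$ for $y\in C$, $y\to x^\nu$; and $N_C(x)=\emptyset$ for $x\notin C$. A set $C\subseteq\mathbb{R}^n$ is *strongly amenable* at $\bar x\in C$ if there are an open neighbourhood $U$ of $\bar x$, a $C^2$ map $G:U\to\mathbb{R}^m$ and a closed convex set $E\subseteq\mathbb{R}^m$ such that $C\cap U=\{x\in U: G(x)\in E\}$ and the only $y\in N_E(G(\bar x))$ with $\nabla G(\bar x)^*y=0$ is $y=0$. It is *prox-regular* at $\bar x\in C$ if it is locally closed at $\bar x$ and for every $\bar v\in N_C(\bar x)$ there are $\varepsilon>0$ and $\rho\ge0$ such that $$\langle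 v,x'-x\rangle\le\tfrac{\rho}{2}\|x'-x\|^2$$ whenever $x,x'\in C$, $\|x-\bar x\|<\varepsilon$, $\|x'-\bar x\|\le\varepsilon$, $v\in N_C(x)$ and $\|v-\bar v\|<\varepsilon$. -/

import Mathlib

open Filter Topology

/-! ## Variational analysis: normal cones, strong amenability, prox-regularity -/

namespace VarAnalysis

/-- Regular (Fréchet) normals: `x ∈ C` and `⟪v, y - x⟫ ≤ o(‖y - x‖)` for `y ∈ C`, `y → x`. -/
def regularNormalCone {n : ℕ} (C : Set (EuclideanSpace ℝ (Fin n)))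
    (x : EuclideanSpace ℝ (Fin n)) : Set (EuclideanSpace ℝ (Fin n)) :=
  {v | x ∈ C ∧ ∀ ε : ℝ, 0 < ε → ∀ᶠ y in 𝓝[C] x, inner ℝ v (y - x) ≤ ε * ‖y - x‖}

/-- The (limiting) normal cone `N_C(x)`: limits of regular normals at points of `C` tending to
`x ∈ C`; it is empty when `x ∉ C`. For convex `C` it is the normal cone of convex analysis. -/
def normalCone {n : ℕ} (C : Set (EuclideanSpace ℝ (Fin n)))
    (x : EuclideanSpace ℝ (Fin n)) : Set (EuclideanSpace ℝ (Fin n)) :=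
  {v | x ∈ C ∧ ∃ u w : ℕ → EuclideanSpace ℝ (Fin n),
    (∀ ν, w ν ∈ regularNormalCone C (u ν)) ∧ Tendsto u atTop (𝓝 x) ∧ Tendsto w atTop (𝓝 v)}

/-- The constraint qualification for the constraint `F(x) ∈ D` at `x`: the only
`y ∈ N_D(F(x))` with `∇F(x)* y = 0` is `y = 0`. -/
def ConstraintQualification {n m : ℕ}
    (F : EuclideanSpace ℝ (Fin n) → EuclideanSpace ℝ (Fin m))
    (D : Set (EuclideanSpace ℝ (Fin m))) (x : EuclideanSpace ℝ (Fin n)) : Prop :=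
  ∀ y ∈ normalCone D (F x), ContinuousLinearMap.adjoint (fderiv ℝ F x) y = 0 → y = 0

/-- `C` is strongly amenable at its point `x`: on an open neighbourhood `U` of `x` it is
`{x' ∈ U : F(x') ∈ D}` with `F` of class `C²` on `U`, `D` closed and convex, and the constraint
qualification holding at `x`. -/
def StronglyAmenableAt {n : ℕ} (C : Set (EuclideanSpace ℝ (Fin n)))
    (x : EuclideanSpace ℝ (Fin n)) : Prop :=
  x ∈ C ∧ ∃ U : Set (EuclideanSpace ℝ (Fin n)), IsOpen U ∧ x ∈ U ∧
    ∃ (m : ℕ) (F : EuclideanSpace ℝ (Fin n) → EuclideanSpace ℝ (Fin m))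
      (D : Set (EuclideanSpace ℝ (Fin m))),
      ContDiffOn ℝ 2 F U ∧ IsClosed D ∧ Convex ℝ D ∧
      C ∩ U = {x' | x' ∈ U ∧ F x' ∈ D} ∧ ConstraintQualification F D x

/-- `C` is prox-regular at `x` for the normal vector `v`. -/
def ProxRegularAtFor {n : ℕ} (C : Set (EuclideanSpace ℝ (Fin n)))
    (x v : EuclideanSpace ℝ (Fin n)) : Prop :=
  x ∈ C ∧ v ∈ normalCone C x ∧ (∃ r : ℝ, 0 < r ∧ IsClosed (C ∩ Metric.closedBall x r)) ∧
    ∃ ε ρ : ℝ, 0 < ε ∧ 0 ≤ ρ ∧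
      ∀ x₁ ∈ C, ‖x₁ - x‖ < ε → ∀ v₁ ∈ normalCone C x₁, ‖v₁ - v‖ < ε →
        ∀ x₂ ∈ C, ‖x₂ - x‖ ≤ ε → inner ℝ v₁ (x₂ - x₁) ≤ ρ / 2 * ‖x₂ - x₁‖ ^ 2

/-- `C` is prox-regular at its point `x`: it is so for every normal vector `v ∈ N_C(x)`. -/
def ProxRegularAt {n : ℕ} (C : Set (EuclideanSpace ℝ (Fin n)))
    (x : EuclideanSpace ℝ (Fin n)) : Prop :=
  x ∈ C ∧ ∀ v ∈ normalCone C x, ProxRegularAtFor C x v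

end VarAnalysis

/-! ## The linearized quadratic-measurement constraints -/

/-- The data entering the constraints of the quadratic observer: system matrix `A`, output
matrix `V`, predictions `xPred j` (for `x̂_{j|j-1}`), corrected estimates `xPost j`
(for `x̂_{j|j}`), quadratic measurements `z j`, and the slack `ζ`. -/
structure QuadObserver (n : ℕ) where
  A : Matrix (Fin n) (Fin n) ℝ
  V : Matrix (Fin n) (Fin n) ℝ
  xPred : ℕ → EuclideanSpace ℝ (Fin n)
  xPost : ℕ → EuclideanSpace ℝ (Fin n)
  z : ℕ → ℝ
  ζ : ℝ

noncomputable section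

namespace QuadObserver

variable {n : ℕ} (S : QuadObserver n)

/-- The linear functional `w ↦ H_j w`, where `H_j = (2 V x̂_{j|j-1})ᵀ`. -/
def H (j : ℕ) (w : EuclideanSpace ℝ (Fin n)) : ℝ :=
  inner ℝ ((2 : ℝ) • Matrix.toEuclideanCLM (𝕜 := ℝ) S.V (S.xPred j)) w

/-- `z̃_j = z_j - x̂_{j|j}ᵀ V x̂_{j|j}`. -/
def zTilde (j : ℕ) : ℝ :=
  S.z j - inner ℝ (S.xPost j) (Matrix.toEuclideanCLM (𝕜 := ℝ) S.V (S.xPost j))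

/-- `L = ‖V‖₂`, the spectral norm. -/
def L : ℝ := ‖Matrix.toEuclideanCLM (𝕜 := ℝ) S.V‖

/-- `A^{-i} x - x̂_{k-i|k-i}`. -/
def residual (k i : ℕ) (x : EuclideanSpace ℝ (Fin n)) : EuclideanSpace ℝ (Fin n) :=
  Matrix.toEuclideanCLM (𝕜 := ℝ) (S.A⁻¹ ^ i) x - S.xPost (k - i)

/-- `δ_{k,i}(x) = ζ + L ‖A^{-i} x - x̂_{k-i|k-i}‖²`. -/
def δ (k i : ℕ) (x : EuclideanSpace ℝ (Fin n)) : ℝ :=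
  S.ζ + S.L * ‖S.residual k i x‖ ^ 2

/-- `φ_i^+(x) = H_{k-i}(A^{-i} x - x̂_{k-i|k-i}) - z̃_{k-i} - δ_{k,i}(x)`. -/
def φPlus (k i : ℕ) (x : EuclideanSpace ℝ (Fin n)) : ℝ :=
  S.H (k - i) (S.residual k i x) - S.zTilde (k - i) - S.δ k i x

/-- `φ_i^-(x) = -H_{k-i}(A^{-i} x - x̂_{k-i|k-i}) + z̃_{k-i} - δ_{k,i}(x)`. -/
def φMinus (k i : ℕ) (x : EuclideanSpace ℝ (Fin n)) : ℝ :=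
  -S.H (k - i) (S.residual k i x) + S.zTilde (k - i) - S.δ k i x

/-- The stacked map `F = (φ_0^+, φ_0^-, …, φ_N^+, φ_N^-)`. -/
def F (k N : ℕ) (x : EuclideanSpace ℝ (Fin n)) : EuclideanSpace ℝ (Fin (2 * (N + 1))) :=
  WithLp.toLp 2 fun j =>
    if (j : ℕ) % 2 = 0 then S.φPlus k ((j : ℕ) / 2) x else S.φMinus k ((j : ℕ) / 2) x

/-- `D = (-∞, 0]^m`. -/
def nonposOrthant (m : ℕ) : Set (EuclideanSpace ℝ (Fin m)) := {y | ∀ j, y j ≤ 0}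

/-- The feasible set `F_k = {x : F(x) ∈ (-∞, 0]^{2(N+1)}}`. -/
def feasibleSet (k N : ℕ) : Set (EuclideanSpace ℝ (Fin n)) :=
  {x | S.F k N x ∈ nonposOrthant (2 * (N + 1))}

/-- The feasible set is `⋂_{i=0}^N {x : |H_{k-i}(A^{-i} x - x̂_{k-i|k-i}) - z̃_{k-i}| ≤ δ_{k,i}(x)}`. -/
theorem mem_feasibleSet_iff (k N : ℕ) (x : EuclideanSpace ℝ (Fin n)) :
    x ∈ S.feasibleSet k N ↔
      ∀ i ≤ N, |S.H (k - i) (S.residual k i x) - S.zTilde (k - i)| ≤ S.δ k i x := by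
  simp only [feasibleSet, nonposOrthant, F, Set.mem_ofPred_eq]
  constructor
  · intro h i hi
    have h1 := h ⟨2 * i, by omega⟩
    have h2 := h ⟨2 * i + 1, by omega⟩
    have e1 : (2 * i) % 2 = 0 := by omega
    have e2 : (2 * i) / 2 = i := by omega
    have e3 : ¬ (2 * i + 1) % 2 = 0 := by omega
    have e4 : (2 * i + 1) / 2 = i := by omega
    simp only [e1, e2, if_true, φPlus] at h1
    simp only [e3, e4, if_false, φMinus] at h2
    rw [abs_le]
    constructor <;> linarith
  · intro h j
    have hj := abs_le.mp (h ((j : ℕ) / 2) (by omega))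
    by_cases hp : (j : ℕ) % 2 = 0
    · simp only [hp, if_true, φPlus]
      linarith [hj.2]
    · simp only [hp, if_false, φMinus]
      linarith [hj.1]

/-- Nondegeneracy at `x`: every active constraint among `φ_i^±`, `0 ≤ i ≤ N`, has nonzero
gradient at `x`. -/
def Nondegenerate (k N : ℕ) (x : EuclideanSpace ℝ (Fin n)) : Prop :=
  ∀ i ≤ N, (S.φPlus k i x = 0 → gradient (S.φPlus k i) x ≠ 0) ∧
    (S.φMinus k i x = 0 → gradient (S.φMinus k i) x ≠ 0)

end QuadObserver

end

/-!
Strong amenability holds because the feasible set is globally the preimage of the closed convex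
orthant under the smooth map `F`, with the constraint qualification as a hypothesis.

Prox-regularity is obtained on the primal side, without multipliers. By Hahn–Banach, the constraint
qualification yields a Slater-type direction `w` along which every active coordinate of `F` strictly
decreases at the base point (`exists_fderiv_neg_of_constraintQualification`), and by continuity this
persists, with a uniform rate `c`, at all nearby feasible points. The coordinates of `F` are
quadratics whose second-order part is bounded below, so `F` satisfies
`F x + F'(x) (y - x) ≤ F y + M ‖y - x‖ ^ 2` coordinatewise. Hence, for feasible `x` near the base
point and feasible `y`, the corrected displacement `d = (y - x) + s ‖y - x‖ ^ 2 w` with `s c > M`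
strictly decreases every constraint active at `x`, so it is a feasible direction, and a regular
normal `v` at `x` satisfies `⟪v, d⟫ ≤ 0` (`inner_nonpos_of_fderiv_neg`), i.e.
`⟪v, y - x⟫ ≤ s ‖w‖ ‖v‖ ‖y - x‖ ^ 2`. This inequality is stable under limits of `x` and `v`, so it
holds for limiting normals too.
-/

/-! ### Sets defined by semiconvex inequality constraints -/

namespace VarAnalysis

open QuadObserver

variable {n m : ℕ}

theorem isClosed_nonposOrthant (m : ℕ) : IsClosed (nonposOrthant m) := by
  have h : nonposOrthant m = ⋂ j, {y : EuclideanSpace ℝ (Fin m) | y j ≤ 0} := by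
    ext y; simp [nonposOrthant]
  rw [h]
  exact isClosed_iInter fun j => isClosed_le (by fun_prop) continuous_const

theorem convex_nonposOrthant (m : ℕ) : Convex ℝ (nonposOrthant m) := by
  intro x hx y hy a b ha hb _ j
  have h₁ := mul_nonpos_of_nonneg_of_nonpos ha (hx j)
  have h₂ := mul_nonpos_of_nonneg_of_nonpos hb (hy j)
  simpa using add_nonpos h₁ h₂

/-- Nonnegative vectors satisfying complementary slackness are normal to the orthant. -/
theorem mem_normalCone_nonposOrthant {p y : EuclideanSpace ℝ (Fin m)} (hp : p ∈ nonposOrthant m)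
    (hy : ∀ j, 0 ≤ y j) (hyp : ∀ j, y j * p j = 0) : y ∈ normalCone (nonposOrthant m) p := by
  refine ⟨hp, fun _ => p, fun _ => y, fun _ => ⟨hp, fun ε hε => ?_⟩, tendsto_const_nhds,
    tendsto_const_nhds⟩
  filter_upwards [self_mem_nhdsWithin] with q hq
  have h : inner ℝ y (q - p) ≤ 0 := by
    rw [PiLp.inner_apply]
    refine Finset.sum_nonpos fun j _ => ?_
    have h₁ := mul_nonpos_of_nonneg_of_nonpos (hy j) (hq j)
    have h₂ := hyp j
    simp only [PiLp.sub_apply, RCLike.inner_apply, conj_trivial]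
    linarith
  exact h.trans (by positivity)

/-- For inequality constraints, the constraint qualification implies the Mangasarian–Fromovitz
condition: some direction strictly decreases all active constraints. -/
theorem exists_fderiv_neg_of_constraintQualification
    {F : EuclideanSpace ℝ (Fin n) → EuclideanSpace ℝ (Fin m)} {x : EuclideanSpace ℝ (Fin n)}
    (hx : F x ∈ nonposOrthant m) (hcq : ConstraintQualification F (nonposOrthant m) x) :
    ∃ w, ∀ j, F x j = 0 → (fderiv ℝ F x w) j < 0 := by
  classical
  set T := ContinuousLinearMap.adjoint (fderiv ℝ F x) with hT
  let e : Fin m → EuclideanSpace ℝ (Fin m) := fun j => EuclideanSpace.single j 1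
  -- `K` consists of the gradients of the active constraints.
  let K : Finset (EuclideanSpace ℝ (Fin n)) :=
    (Finset.univ.filter fun j => F x j = 0).image fun j => T (e j)
  have h0 : (0 : EuclideanSpace ℝ (Fin n)) ∉ convexHull ℝ (K : Set _) := by
    intro h
    have hsub : convexHull ℝ (K : Set (EuclideanSpace ℝ (Fin n))) ⊆
        T '' (convexHull ℝ (e '' {j | F x j = 0})) := by
      have : (K : Set (EuclideanSpace ℝ (Fin n))) = T '' (e '' {j | F x j = 0}) := by
        simp [K, Set.image_image]
      rw [this]
      exact (T.toLinearMap.image_convexHull _).ge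
    obtain ⟨y, hy, hTy⟩ := hsub h
    -- Every convex combination of the active unit vectors is an admissible nonzero multiplier.
    have hconv : Convex ℝ {y : EuclideanSpace ℝ (Fin m) |
        (∀ j, 0 ≤ y j) ∧ (∀ j, y j * F x j = 0) ∧ ∑ j, y j = 1} := by
      rintro a ⟨ha, ha', ha''⟩ b ⟨hb, hb', hb''⟩ s t hs ht hst
      refine ⟨fun j => ?_, fun j => ?_, ?_⟩
      · have := mul_nonneg hs (ha j)
        have := mul_nonneg ht (hb j)
        simp only [PiLp.add_apply, PiLp.smul_apply, smul_eq_mul]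
        linarith
      · simp only [PiLp.add_apply, PiLp.smul_apply, smul_eq_mul]
        linear_combination s * ha' j + t * hb' j
      · simp [Finset.sum_add_distrib, ← Finset.mul_sum, ha'', hb'', hst]
    have hmem := convexHull_min (s := e '' {j | F x j = 0}) (by
      rintro _ ⟨i, hi, rfl⟩
      refine ⟨fun j => ?_, fun j => ?_, ?_⟩
      · by_cases hij : j = i <;> simp [e, hij]
      · by_cases hij : j = i
        · subst hij
          exact mul_eq_zero_of_right _ hi
        · simp [e, hij]
      · simp [e]) hconv hy
    have hy0 := hcq y (mem_normalCone_nonposOrthant hx hmem.1 hmem.2.1) hTy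
    simpa [hy0] using hmem.2.2
  obtain ⟨f, u, hf, hfu⟩ := geometric_hahn_banach_point_closed (convex_convexHull ℝ _)
    (Set.Finite.isClosed_convexHull ℝ K.finite_toSet) h0
  obtain ⟨w, hw⟩ := (InnerProductSpace.toDual ℝ _).surjective f
  refine ⟨-w, fun j hj => ?_⟩
  have h₁ : T (e j) ∈ convexHull ℝ (K : Set (EuclideanSpace ℝ (Fin n))) := by
    refine subset_convexHull ℝ _ ?_
    simp only [K, Finset.coe_image, Finset.coe_filter, Finset.mem_univ, true_and]
    exact ⟨j, hj, rfl⟩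
  have h₂ := hfu _ h₁
  rw [map_zero] at hf
  rw [← hw, InnerProductSpace.toDual_apply_apply, hT, ContinuousLinearMap.adjoint_inner_right] at h₂
  simp only [e, EuclideanSpace.inner_single_right] at h₂
  simp only [map_neg, PiLp.neg_apply]
  simp at h₂
  linarith

/-- A direction strictly decreasing all constraints active at `u` makes a nonacute angle with
every regular normal at `u`. -/
theorem inner_nonpos_of_fderiv_neg
    {F : EuclideanSpace ℝ (Fin n) → EuclideanSpace ℝ (Fin m)} {u v d : EuclideanSpace ℝ (Fin n)}
    (hF : DifferentiableAt ℝ F u) (hv : v ∈ regularNormalCone {x | F x ∈ nonposOrthant m} u)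
    (hd : ∀ j, F u j = 0 → (fderiv ℝ F u d) j < 0) : inner ℝ v d ≤ 0 := by
  have hline : HasDerivAt (fun t : ℝ => u + t • d) d 0 := by
    simpa using ((hasDerivAt_id (0 : ℝ)).smul_const d).const_add u
  have hderiv : HasDerivAt (fun t : ℝ => F (u + t • d)) (fderiv ℝ F u d) 0 := by
    have h : HasFDerivAt F (fderiv ℝ F u) (u + (0 : ℝ) • d) := by simpa using hF.hasFDerivAt
    exact h.comp_hasDerivAt 0 hline
  have hfeas : ∀ᶠ t in 𝓝[>] (0 : ℝ), u + t • d ∈ {x | F x ∈ nonposOrthant m} := by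
    refine Filter.eventually_all.2 fun j => ?_
    have hj : HasDerivAt (fun t : ℝ => F (u + t • d) j) ((fderiv ℝ F u d) j) 0 :=
      (EuclideanSpace.proj (𝕜 := ℝ) j).hasFDerivAt.comp_hasDerivAt 0 hderiv
    rcases (hv.1 j).lt_or_eq with hlt | heq
    · have h0 : F (u + (0 : ℝ) • d) j < 0 := by simpa using hlt
      exact ((hj.continuousAt.eventually_lt continuousAt_const h0).filter_mono
        nhdsWithin_le_nhds).mono fun t ht => ht.le
    · filter_upwards [hj.tendsto_slope_zero_right.eventually_lt_const (hd j heq),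
        self_mem_nhdsWithin] with t ht ht0
      have ht0 : 0 < t := ht0
      have : t⁻¹ * F (u + t • d) j < 0 := by simpa [heq] using ht
      exact (neg_of_mul_neg_right this (inv_nonneg.2 ht0.le)).le
  have htend : Tendsto (fun t : ℝ => u + t • d) (𝓝[>] 0) (𝓝[{x | F x ∈ nonposOrthant m}] u) := by
    refine tendsto_nhdsWithin_iff.2 ⟨?_, hfeas⟩
    have := hline.continuousAt.tendsto
    simp only [zero_smul, add_zero] at this
    exact this.mono_left nhdsWithin_le_nhds
  have key : ∀ ε : ℝ, 0 < ε → inner ℝ v d ≤ ε * ‖d‖ := by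
    intro ε hε
    obtain ⟨t, ht, ht0⟩ := ((htend.eventually (hv.2 ε hε)).and self_mem_nhdsWithin).exists
    have ht0 : 0 < t := ht0
    rw [add_sub_cancel_left, inner_smul_right, norm_smul, Real.norm_of_nonneg ht0.le] at ht
    exact le_of_mul_le_mul_left (by linarith) ht0
  have hlim : Tendsto (fun ε : ℝ => ε * ‖d‖) (𝓝[>] 0) (𝓝 0) := by
    have : Tendsto (fun ε : ℝ => ε * ‖d‖) (𝓝 0) (𝓝 (0 * ‖d‖)) :=
      tendsto_id.mul_const _
    rw [zero_mul] at this
    exact this.mono_left nhdsWithin_le_nhds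
  exact ge_of_tendsto hlim (by filter_upwards [self_mem_nhdsWithin] with ε hε using key ε hε)

/-- A Slater-type direction persists near the base point: constraints inactive at `x` stay
inactive, and the active ones keep a uniform rate of decrease. -/
theorem exists_uniform_fderiv_neg
    {F : EuclideanSpace ℝ (Fin n) → EuclideanSpace ℝ (Fin m)} {x w : EuclideanSpace ℝ (Fin n)}
    (hF : ContDiff ℝ 1 F) (hx : F x ∈ nonposOrthant m)
    (hw : ∀ j, F x j = 0 → (fderiv ℝ F x w) j < 0) :
    ∃ c > 0, ∀ᶠ u in 𝓝 x, ∀ j, F u j = 0 → (fderiv ℝ F u w) j ≤ -c := by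
  have hcont : ∀ j, Continuous fun u => (fderiv ℝ F u w) j := fun j =>
    (EuclideanSpace.proj (𝕜 := ℝ) j).continuous.comp
      ((hF.continuous_fderiv one_ne_zero).clm_apply continuous_const)
  have hcontF : ∀ j, Continuous fun u => F u j := fun j =>
    (EuclideanSpace.proj (𝕜 := ℝ) j).continuous.comp hF.continuous
  have hj : ∀ j, ∃ c > 0, ∀ᶠ u in 𝓝 x, F u j = 0 → (fderiv ℝ F u w) j ≤ -c := by
    intro j
    rcases (hx j).lt_or_eq with hlt | heq
    · refine ⟨1, one_pos, ?_⟩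
      filter_upwards [(hcontF j).continuousAt.eventually_lt continuousAt_const hlt] with u hu h0
      exact absurd h0 hu.ne
    · have hneg := hw j heq
      refine ⟨-(fderiv ℝ F x w) j / 2, by linarith, ?_⟩
      have h : (fderiv ℝ F x w) j < (fderiv ℝ F x w) j / 2 := by linarith
      filter_upwards [(hcont j).continuousAt.eventually_lt continuousAt_const h] with u hu _
      linarith
  choose c hc hcu using hj
  obtain ⟨c₀, hc₀, hle⟩ : ∃ c₀ > 0, ∀ j, c₀ ≤ c j := by
    rcases isEmpty_or_nonempty (Fin m) with _ | _
    · exact ⟨1, one_pos, fun j => isEmptyElim j⟩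
    · obtain ⟨i, hi⟩ := Finite.exists_min c
      exact ⟨c i, hc i, hi⟩
  refine ⟨c₀, hc₀, ?_⟩
  filter_upwards [Filter.eventually_all.2 hcu] with u hu j h0
  linarith [hu j h0, hle j]

/-- Sets cut out by finitely many `C¹` inequality constraints whose first-order Taylor errors are
bounded below by `-M ‖y - x‖ ^ 2` are prox-regular wherever the constraint qualification holds. -/
theorem proxRegularAt_of_constraintQualification
    {F : EuclideanSpace ℝ (Fin n) → EuclideanSpace ℝ (Fin m)} {x : EuclideanSpace ℝ (Fin n)}
    (hF : ContDiff ℝ 1 F) {M : ℝ} (hM0 : 0 ≤ M)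
    (hM : ∀ p q j, F p j + (fderiv ℝ F p (q - p)) j ≤ F q j + M * ‖q - p‖ ^ 2)
    (hx : F x ∈ nonposOrthant m) (hcq : ConstraintQualification F (nonposOrthant m) x) :
    ProxRegularAt {p | F p ∈ nonposOrthant m} x := by
  have hclosed : IsClosed {p | F p ∈ nonposOrthant m} :=
    (isClosed_nonposOrthant m).preimage hF.continuous
  obtain ⟨w, hw⟩ := exists_fderiv_neg_of_constraintQualification hx hcq
  obtain ⟨c, hc, hev⟩ := exists_uniform_fderiv_neg hF hx hw
  obtain ⟨ε, hε, hball⟩ := Metric.eventually_nhds_iff.1 hev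
  set s : ℝ := (M + 1) / c with hs
  have hs0 : 0 ≤ s := by positivity
  have hregular : ∀ u, dist u x < ε → ∀ v ∈ regularNormalCone {p | F p ∈ nonposOrthant m} u,
      ∀ y, F y ∈ nonposOrthant m →
        inner ℝ v (y - u) ≤ s * ‖w‖ * ‖v‖ * ‖y - u‖ ^ 2 := by
    intro u hu v hv y hy
    rcases eq_or_ne y u with rfl | hne
    · simp
    have hpos : 0 < ‖y - u‖ ^ 2 := by
      have := norm_pos_iff.2 (sub_ne_zero.2 hne)
      positivity
    -- The correction along `w` absorbs the semiconvexity error: `s * c = M + 1 > M`.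
    have hdir := inner_nonpos_of_fderiv_neg (d := (y - u) + (s * ‖y - u‖ ^ 2) • w)
      (hF.differentiable one_ne_zero u) hv (fun j hj => by
        have h₁ := hM u y j
        have h₂ := mul_le_mul_of_nonneg_left (hball hu j hj) (mul_nonneg hs0 hpos.le)
        have h₃ : s * ‖y - u‖ ^ 2 * -c = -((M + 1) * ‖y - u‖ ^ 2) := by
          rw [hs]; field_simp
        have h₄ := hy j
        rw [map_add, map_smul, PiLp.add_apply, PiLp.smul_apply, smul_eq_mul]
        linarith)
    rw [inner_add_right, inner_smul_right] at hdir
    have h₁ : -inner ℝ v w ≤ ‖v‖ * ‖w‖ := (neg_le_abs _).trans (abs_real_inner_le_norm v w)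
    have h₂ := mul_le_mul_of_nonneg_left h₁ (mul_nonneg hs0 hpos.le)
    linarith
  have hlimiting : ∀ u, dist u x < ε → ∀ v ∈ normalCone {p | F p ∈ nonposOrthant m} u,
      ∀ y, F y ∈ nonposOrthant m →
        inner ℝ v (y - u) ≤ s * ‖w‖ * ‖v‖ * ‖y - u‖ ^ 2 := by
    rintro u hu v ⟨-, a, b, hab, ha, hb⟩ y hy
    have hnear : ∀ᶠ ν in atTop, dist (a ν) x < ε :=
      (ha.dist tendsto_const_nhds).eventually_lt_const hu
    have hya : Tendsto (fun ν => y - a ν) atTop (𝓝 (y - u)) := tendsto_const_nhds.sub ha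
    refine le_of_tendsto_of_tendsto (hb.inner hya)
      ((hb.norm.const_mul (s * ‖w‖)).mul (hya.norm.pow 2)) ?_
    filter_upwards [hnear] with ν hν using hregular _ hν _ (hab ν) y hy
  refine ⟨hx, fun v hv => ⟨hx, hv, ⟨1, one_pos, hclosed.inter Metric.isClosed_closedBall⟩,
    ε, 2 * (s * ‖w‖ * (‖v‖ + ε)), hε, by positivity, ?_⟩⟩
  intro x₁ _ hx₁ v₁ hv₁ hv₁v x₂ hx₂ _
  have hnorm : ‖v₁‖ ≤ ‖v‖ + ε := by
    have := norm_sub_norm_le v₁ v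
    linarith
  calc inner ℝ v₁ (x₂ - x₁) ≤ s * ‖w‖ * ‖v₁‖ * ‖x₂ - x₁‖ ^ 2 :=
        hlimiting x₁ (by rwa [dist_eq_norm]) v₁ hv₁ x₂ hx₂
    _ ≤ s * ‖w‖ * (‖v‖ + ε) * ‖x₂ - x₁‖ ^ 2 := by gcongr
    _ = 2 * (s * ‖w‖ * (‖v‖ + ε)) / 2 * ‖x₂ - x₁‖ ^ 2 := by ring

end VarAnalysis

/-! ### The quadratic observer constraints -/

namespace QuadObserver

variable {n : ℕ} (S : QuadObserver n)

theorem contDiff_residual (k i : ℕ) : ContDiff ℝ 2 (S.residual k i) := by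
  unfold residual
  fun_prop

theorem contDiff_δ (k i : ℕ) : ContDiff ℝ 2 (S.δ k i) :=
  contDiff_const.add (contDiff_const.mul ((S.contDiff_residual k i).norm_sq ℝ))

theorem contDiff_H_residual (k i : ℕ) : ContDiff ℝ 2 fun x => S.H (k - i) (S.residual k i x) :=
  contDiff_const.inner ℝ (S.contDiff_residual k i)

theorem contDiff_φPlus (k i : ℕ) : ContDiff ℝ 2 (S.φPlus k i) :=
  ((S.contDiff_H_residual k i).sub contDiff_const).sub (S.contDiff_δ k i)

theorem contDiff_φMinus (k i : ℕ) : ContDiff ℝ 2 (S.φMinus k i) :=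
  ((S.contDiff_H_residual k i).neg.add contDiff_const).sub (S.contDiff_δ k i)

theorem contDiff_F (k N : ℕ) : ContDiff ℝ 2 (S.F k N) := by
  refine contDiff_euclidean.2 fun j => ?_
  by_cases hj : (j : ℕ) % 2 = 0
  · simpa [F, hj] using S.contDiff_φPlus k (j / 2)
  · simpa [F, hj] using S.contDiff_φMinus k (j / 2)

/-- The first-order Taylor expansion of an affine function minus a multiple of a squared norm has
an exact quadratic remainder. -/
theorem taylor_sub_norm_sq {E G : Type*} [NormedAddCommGroup E] [InnerProductSpace ℝ E]
    [NormedAddCommGroup G] [InnerProductSpace ℝ G] (B : E →L[ℝ] G) (b h : G) (c l : ℝ)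
    (p q : E) :
    (inner ℝ h (B p - b) - c - l * ‖B p - b‖ ^ 2) +
        fderiv ℝ (fun x => inner ℝ h (B x - b) - c - l * ‖B x - b‖ ^ 2) p (q - p) =
      (inner ℝ h (B q - b) - c - l * ‖B q - b‖ ^ 2) + l * ‖B (q - p)‖ ^ 2 := by
  have hB : HasFDerivAt (fun x => B x - b) B p := B.hasFDerivAt.sub_const b
  have hf := (((innerSL ℝ h).hasFDerivAt.comp p hB).sub_const c).sub (hB.norm_sq.const_mul l)
  have hf' : HasFDerivAt (fun x => inner ℝ h (B x - b) - c - l * ‖B x - b‖ ^ 2) _ p := hf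
  rw [hf'.fderiv]
  have hq : B q - b = (B p - b) + B (q - p) := by rw [map_sub]; abel
  rw [hq, norm_add_sq_real, inner_add_right]
  simp only [sub_apply, smul_apply,
    ContinuousLinearMap.comp_apply, innerSL_apply_apply, smul_eq_mul, nsmul_eq_mul, Nat.cast_ofNat]
  ring

theorem φPlus_add_fderiv (k i : ℕ) (p q : EuclideanSpace ℝ (Fin n)) :
    S.φPlus k i p + fderiv ℝ (S.φPlus k i) p (q - p) =
      S.φPlus k i q + S.L * ‖Matrix.toEuclideanCLM (𝕜 := ℝ) (S.A⁻¹ ^ i) (q - p)‖ ^ 2 := by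
  have h : S.φPlus k i = fun x =>
      inner ℝ ((2 : ℝ) • Matrix.toEuclideanCLM (𝕜 := ℝ) S.V (S.xPred (k - i)))
        (Matrix.toEuclideanCLM (𝕜 := ℝ) (S.A⁻¹ ^ i) x - S.xPost (k - i)) -
      (S.zTilde (k - i) + S.ζ) -
      S.L * ‖Matrix.toEuclideanCLM (𝕜 := ℝ) (S.A⁻¹ ^ i) x - S.xPost (k - i)‖ ^ 2 := by
    funext x
    simp only [φPlus, H, δ, residual]
    ring
  rw [h]
  exact taylor_sub_norm_sq _ _ _ _ _ _ _

theorem φMinus_add_fderiv (k i : ℕ) (p q : EuclideanSpace ℝ (Fin n)) :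
    S.φMinus k i p + fderiv ℝ (S.φMinus k i) p (q - p) =
      S.φMinus k i q + S.L * ‖Matrix.toEuclideanCLM (𝕜 := ℝ) (S.A⁻¹ ^ i) (q - p)‖ ^ 2 := by
  have h : S.φMinus k i = fun x =>
      inner ℝ (-((2 : ℝ) • Matrix.toEuclideanCLM (𝕜 := ℝ) S.V (S.xPred (k - i))))
        (Matrix.toEuclideanCLM (𝕜 := ℝ) (S.A⁻¹ ^ i) x - S.xPost (k - i)) -
      (-S.zTilde (k - i) + S.ζ) -
      S.L * ‖Matrix.toEuclideanCLM (𝕜 := ℝ) (S.A⁻¹ ^ i) x - S.xPost (k - i)‖ ^ 2 := by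
    funext x
    simp only [φMinus, H, δ, residual, inner_neg_left]
    ring
  rw [h]
  exact taylor_sub_norm_sq _ _ _ _ _ _ _

/-- The expansion of each coordinate of `F` is exact; the remainder is the same for `φ_i^+` and
`φ_i^-`. -/
theorem F_add_fderiv (k N : ℕ) (p q : EuclideanSpace ℝ (Fin n)) (j : Fin (2 * (N + 1))) :
    S.F k N p j + (fderiv ℝ (S.F k N) p (q - p)) j = S.F k N q j +
      S.L * ‖Matrix.toEuclideanCLM (𝕜 := ℝ) (S.A⁻¹ ^ ((j : ℕ) / 2)) (q - p)‖ ^ 2 := by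
  have hdiff : DifferentiableAt ℝ (S.F k N) p := (S.contDiff_F k N).differentiable two_ne_zero p
  have hcomp : HasFDerivAt (fun x => S.F k N x j)
      ((EuclideanSpace.proj (𝕜 := ℝ) j).comp (fderiv ℝ (S.F k N) p)) p :=
    (EuclideanSpace.proj (𝕜 := ℝ) j).hasFDerivAt.comp p hdiff.hasFDerivAt
  have heq : (fderiv ℝ (S.F k N) p (q - p)) j = fderiv ℝ (fun x => S.F k N x j) p (q - p) := by
    rw [hcomp.fderiv]
    rfl
  rw [heq]
  by_cases hj : (j : ℕ) % 2 = 0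
  · simpa [F, hj] using S.φPlus_add_fderiv k (j / 2) p q
  · simpa [F, hj] using S.φMinus_add_fderiv k (j / 2) p q

theorem exists_mul_norm_sq_le {ι E G : Type*} [Fintype ι] [NormedAddCommGroup E]
    [NormedSpace ℝ E] [NormedAddCommGroup G] [NormedSpace ℝ G] (B : ι → E →L[ℝ] G) {l : ℝ}
    (hl : 0 ≤ l) : ∃ M : ℝ, 0 ≤ M ∧ ∀ j d, l * ‖B j d‖ ^ 2 ≤ M * ‖d‖ ^ 2 := by
  refine ⟨∑ j, l * ‖B j‖ ^ 2, by positivity, fun j d => ?_⟩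
  calc l * ‖B j d‖ ^ 2 ≤ l * (‖B j‖ * ‖d‖) ^ 2 := by
        gcongr
        exact (B j).le_opNorm _
    _ = l * ‖B j‖ ^ 2 * ‖d‖ ^ 2 := by ring
    _ ≤ (∑ j, l * ‖B j‖ ^ 2) * ‖d‖ ^ 2 := by
        gcongr
        exact Finset.single_le_sum (f := fun j => l * ‖B j‖ ^ 2)
          (fun i _ => by positivity) (Finset.mem_univ j)

theorem exists_F_add_fderiv_le (k N : ℕ) : ∃ M : ℝ, 0 ≤ M ∧ ∀ p q j,
    S.F k N p j + (fderiv ℝ (S.F k N) p (q - p)) j ≤ S.F k N q j + M * ‖q - p‖ ^ 2 := by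
  obtain ⟨M, hM0, hM⟩ := exists_mul_norm_sq_le (fun j : Fin (2 * (N + 1)) =>
    Matrix.toEuclideanCLM (𝕜 := ℝ) (S.A⁻¹ ^ ((j : ℕ) / 2))) (l := S.L) (norm_nonneg _)
  refine ⟨M, hM0, fun p q j => ?_⟩
  rw [F_add_fderiv]
  have := hM j (q - p)
  linarith

end QuadObserver

theorem mainTheorem2 {n : ℕ} (S : QuadObserver n) (k N : ℕ) (hNk : N ≤ k)
    (hV : S.V.PosDef) (xbar : EuclideanSpace ℝ (Fin n))
    (hx : xbar ∈ S.feasibleSet k N)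
    (hA : IsUnit S.A)
    (hnd : S.Nondegenerate k N xbar)
    (hcq : VarAnalysis.ConstraintQualification (S.F k N)
      (QuadObserver.nonposOrthant (2 * (N + 1))) xbar) :
    VarAnalysis.StronglyAmenableAt (S.feasibleSet k N) xbar ∧
      VarAnalysis.ProxRegularAt (S.feasibleSet k N) xbar := by
  have hF := S.contDiff_F k N
  refine ⟨⟨hx, Set.univ, isOpen_univ, Set.mem_univ _, _, S.F k N,
    QuadObserver.nonposOrthant _, hF.contDiffOn, VarAnalysis.isClosed_nonposOrthant _,
    VarAnalysis.convex_nonposOrthant _, ?_, hcq⟩, ?_⟩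
  · ext x
    simp [QuadObserver.feasibleSet]
  · obtain ⟨M, hM0, hM⟩ := S.exists_F_add_fderiv_le k N
    exact VarAnalysis.proxRegularAt_of_constraintQualification (hF.of_le one_le_two) hM0 hM hx hcq
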